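/- Work in a big model $M$ of a complete, possibly many-sorted, first-order theory $T$: for some uncountable $\kappa$, $M$ is $\kappa$-saturated and strongly $\kappa$-homogeneous. "Small" means of cardinality $<\kappa$; all sets $A,B,C,D,\hat B$ below are small sets of elements of $M$, and we write $BC=B\cup C$. Formulas are considered up to equivalence in $M$. Write $A'\equiv_{D}A$ if some automorphism of $M$ fixing $D$ pointwise maps $A$ onto $A'$. **Inconsistency pairs.** An inconsistency pair is a pair $(\phi(\bar x;\bar y),\psi(\bar y_0,\dots,\bar y_{k-1}))$ of formulas, with $k<\omega$, such that $\bigwedge_{i<k}\phi(\bar x;\bar y_i)\wedge\psi(\bar y_0,\dots,\bar y_{k-1})$ is inconsistent; the partition of the variables is part of the datum. For such a pair, $\phi(\bar x;\bar b)$ *$(\phi,\psi)$-divides over* $C$ if there is a sequence $(\bar b_i)_{i<\omega}$ of realisations of $\operatorname{tp}(\bar b/C)$ with $\models\psi(\bar b_{i_0},\dots,\bar b_{i_{k-1}})$ for all $i_0<\dots<i_{k-1}<\omega$. **Independence.** Let $\Omega$ be a set of inconsistency pairs that is closed under variable substitution: if $(\phi(\bar x;\bar y),\psi(\bar y_0,\dots,\bar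 y_{k-1}))\in\Omega$ then $(\phi(\bar u;\bar v),\psi(\bar v_0,\dots,\bar v_{k-1}))\in\Omega$ for all matching tuples of variables $\bar u,\bar v,\bar v_0,\dots,\bar v_{k-1}$, possibly with repetitions but pairwise disjoint. Define * $A\perp^{\Omega}_C B$ iff there are no tuples $\bar a$ from $A$ and $\bar b$ from $BC$ and no $(\phi,\psi)\in\Omega$ such that $\models\phi(\bar a;\bar b)$ and $\phi(\bar x;\bar b)$ $(\phi,\psi)$-divides over $C$; * $A\perp^{\Omega*}_C B$ iff for every $\hat B\supseteq B$ there is $A'\equiv_{BC}A$ with $A'\perp^{\Omega}_C\hat B$. When a tuple stands in place of a set, the set of its entries is meant. Call $\Omega$ *transitive* if, for all $(\phi(\bar x;\bar y),\psi)\in\Omega$, all $D\subseteq C$ and all $\bar b$ with $C\perp^{\Omega}_D\bar b$: if $\phi(\bar x;\bar b)$ $(\phi,\psi)$-divides over $D$, then it $(\phi,\psi)$-divides over $C$. Call $\Omega$ *normal* if $(\phi(\bar x,\bar z;\bar y),\psi(\bar y_0,\dots,\bar y_{k-1}))\in\Omega$ implies $(\phi(\bar x;\bar z,\bar y),\psi(\bar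 y_0,\dots,\bar y_{k-1})\wedge\bar z_0=\dots=\bar z_{k-1})\in\Omega$. **Local rank.** For a small, possibly infinite, tuple of variables $\bar x$ let $\Omega{\upharpoonright}\bar x$ be the set of those pairs in $\Omega$ whose first formula has the form $\phi(\bar x;\bar y)$ (with arbitrary $\bar y$). Let $p(\bar x)$ be a partial type over $C$ and $\Delta\subseteq\Omega{\upharpoonright}\bar x$ finite. A $\Delta$-dividing pattern of length $n<\omega$ for $p$ is a sequence $((\phi^i,\psi^i))_{i<n}$ in $\Delta$ for which there are tuples $\bar b^0,\dots,\bar b^{n-1}$ such that $p(\bar x)\cup\{\phi^i(\bar x;\bar b^i):i<n\}$ is consistent and each $\phi^i(\bar x;\bar b^i)$ $(\phi^i,\psi^i)$-divides over $C\cup\bar b^0\cup\dots\cup\bar b^{i-1}$. Let $D_\Delta(p)\in\omega\cup\{\infty\}$ be the greatest length of a $\Delta$-dividing pattern for $p$, or $\infty$ if there are arbitrarily long ones. Write $D_\Delta(\bar a/B)=D_\Delta(\operatorname{tp}(\bar a/B))$, and $D_\Delta(\emptyset)$ for the rank of the empty type in the variables $\bar x$ over $\emptyset$. **Theorem.** Let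 $\Omega$ be a set of inconsistency pairs, closed under variable substitution, that is transitive and normal, and suppose $D_\Delta(\emptyset)<\infty$ for every small tuple of variables $\bar x$ and every finite $\Delta\subseteq\Omega{\upharpoonright}\bar x$. Then for every small (possibly infinite) tuple $\bar a$, with corresponding tuple of variables $\bar x$, and all small sets $B,C$, the following are equivalent: 1. $\bar a\perp^{\Omega*}_C B$; 2. $D_\Delta(\bar a/BC)=D_\Delta(\bar a/C)$ for all finite $\Delta\subseteq\Omega{\upharpoonright}\bar x$; 3. $B\perp^{\Omega*}_C\bar a$. In particular $\perp^{\Omega*}$ is symmetric: $A\perp^{\Omega*}_C B$ iff $B\perp^{\Omega*}_C A$ for all small sets $A,B,C$. -/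

import Mathlib

open Cardinal

universe u x y

/-! ### Many-sorted first-order logic -/

/-- A many-sorted first-order signature with set of sorts `S`: function symbols of every
arity `s₁ ⋯ sₙ → s` and relation symbols of every arity `s₁ ⋯ sₙ`. Taking `S` to be a one-point
type gives ordinary one-sorted signatures. -/
structure SortedLanguage (S : Type u) where
  Functions : List S → S → Type u
  Relations : List S → Type u

namespace SortedLanguage

variable {S : Type u}

/-- An interpretation of the signature `L` in the family of carriers `M`. -/
class Structure (L : SortedLanguage S) (M : S → Type u) where
  funMap : ∀ {l : List S} {s : S}, L.Functions l s → (∀ i : Fin l.length, M (l.get i)) → M s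
  RelMap : ∀ {l : List S}, L.Relations l → (∀ i : Fin l.length, M (l.get i)) → Prop

/-- Terms of sort `s` in variables indexed by `X`, the variable `i` being of sort `τ i`. -/
inductive Term (L : SortedLanguage S) {X : Type x} (τ : X → S) : S → Type (max u x)
  | var (i : X) : Term L τ (τ i)
  | func {l : List S} {s : S} (f : L.Functions l s)
      (ts : ∀ i : Fin l.length, Term L τ (l.get i)) : Term L τ s

/-- First-order formulas with free variables indexed by `X` (with sorts `τ`) and with a
list `Γ` of (sorts of) variables that are still to be bound. -/
inductive BoundedFormula (L : SortedLanguage S) {X : Type x} (τ : X → S) :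
    List S → Type (max u x)
  | falsum {Γ : List S} : BoundedFormula L τ Γ
  | equal {Γ : List S} {s : S} (t₁ t₂ : Term L (Sum.elim τ Γ.get) s) : BoundedFormula L τ Γ
  | rel {Γ l : List S} (R : L.Relations l)
      (ts : ∀ i : Fin l.length, Term L (Sum.elim τ Γ.get) (l.get i)) : BoundedFormula L τ Γ
  | imp {Γ : List S} (φ₁ φ₂ : BoundedFormula L τ Γ) : BoundedFormula L τ Γ
  | all {Γ : List S} (s : S) (φ : BoundedFormula L τ (s :: Γ)) : BoundedFormula L τ Γ

/-- First-order formulas whose free variables are among those indexed by `X` (with sorts `τ`). -/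
abbrev Formula (L : SortedLanguage S) {X : Type x} (τ : X → S) : Type (max u x) :=
  BoundedFormula L τ []

end SortedLanguage

namespace LocalForking

open SortedLanguage

variable {S : Type u} {L : SortedLanguage S} {M : S → Type u}

/-- A tuple of elements of `M` indexed by `X`, with sorts `τ`; `X` may be infinite. -/
abbrev Tuple (M : S → Type u) {X : Type x} (τ : X → S) : Type (max u x) :=
  ∀ i : X, M (τ i)

/-- Concatenation of two tuples. -/
def Tuple.join {X : Type x} {Y : Type y} {τ : X → S} {υ : Y → S}
    (a : Tuple M τ) (b : Tuple M υ) : Tuple M (Sum.elim τ υ)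
  | .inl i => a i
  | .inr j => b j

/-- The value of a term. -/
def termValue [L.Structure M] {X : Type x} {τ : X → S} (v : Tuple M τ) :
    ∀ {s : S}, L.Term τ s → M s
  | _, .var i => v i
  | _, .func f ts => Structure.funMap f (fun i => termValue v (ts i))

/-- Tarskian truth, with the free variables evaluated by `v` and the bound ones by `w`. -/
def boundedHolds [L.Structure M] {X : Type x} {τ : X → S} (v : Tuple M τ) :
    ∀ {Γ : List S}, L.BoundedFormula τ Γ → Tuple M Γ.get → Prop
  | _, .falsum, _ => False
  | _, .equal t₁ t₂, w => termValue (v.join w) t₁ = termValue (v.join w) t₂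
  | _, .rel R ts, w => Structure.RelMap R (fun i => termValue (v.join w) (ts i))
  | _, .imp φ₁ φ₂, w => boundedHolds v φ₁ w → boundedHolds v φ₂ w
  | Γ, .all s φ, w =>
      ∀ a : M s, boundedHolds v φ (Fin.cons (α := fun i => M ((s :: Γ).get i)) a w)

/-- `Holds φ v` means `M ⊨ φ(v)`. -/
def Holds [L.Structure M] {X : Type x} {τ : X → S} (φ : L.Formula τ) (v : Tuple M τ) : Prop :=
  boundedHolds v φ (fun i => i.elim0)

/-- Elements of `M` of arbitrary sort. -/
abbrev Elem (M : S → Type u) : Type u := Σ s : S, M s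

/-- The set of elements occurring in a tuple. -/
def Tuple.toSet {X : Type x} {τ : X → S} (a : Tuple M τ) : Set (Elem M) :=
  Set.range fun i => (⟨τ i, a i⟩ : Elem M)

/-- Automorphisms of `M`. -/
structure Automorphism (L : SortedLanguage S) (M : S → Type u) [L.Structure M] where
  toEquiv : ∀ s : S, M s ≃ M s
  map_fun : ∀ {l : List S} {s : S} (f : L.Functions l s) (a : ∀ i : Fin l.length, M (l.get i)),
    toEquiv s (Structure.funMap f a) = Structure.funMap f (fun i => toEquiv (l.get i) (a i))
  map_rel : ∀ {l : List S} (R : L.Relations l) (a : ∀ i : Fin l.length, M (l.get i)),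
    Structure.RelMap R (fun i => toEquiv (l.get i) (a i)) ↔ Structure.RelMap R a

/-- The action of an automorphism on elements of arbitrary sort. -/
def Automorphism.apply [L.Structure M] (g : Automorphism L M) (e : Elem M) : Elem M :=
  ⟨e.1, g.toEquiv e.1 e.2⟩

/-! ### Types and big models -/

/-- The sorts of the elements of `C`, seen as a tuple indexed by itself. -/
abbrev sortsOf (C : Set (Elem M)) : C → S := fun c => c.1.1

/-- `C` as a tuple indexed by itself. -/
def enum (C : Set (Elem M)) : Tuple M (sortsOf C) := fun c => c.1.2

/-- Sets of formulas `φ(x̄, c̄)` with parameters `c̄` from `C`, where `x̄` is a tuple of variables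
indexed by `ι` with sorts `τ`. -/
abbrev PartialType (L : SortedLanguage S) {ι : Type x} (τ : ι → S) (C : Set (Elem M)) :
    Type (max u x) :=
  Set (L.Formula (Sum.elim τ (sortsOf C)))

/-- The tuple `a` realises the partial type `p`. -/
def Realises [L.Structure M] {ι : Type x} {τ : ι → S} {C : Set (Elem M)}
    (a : Tuple M τ) (p : PartialType L τ C) : Prop :=
  ∀ φ ∈ p, Holds φ (a.join (enum C))

/-- The complete type `tp(a/C)`. -/
def tp (L : SortedLanguage S) [L.Structure M] {ι : Type x} {τ : ι → S}
    (a : Tuple M τ) (C : Set (Elem M)) : PartialType L τ C :=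
  {φ | Holds φ (a.join (enum C))}

/-- `M` is a big model, where "small" means "of cardinality less than `κ`": it is `κ`-saturated
and strongly `κ`-homogeneous for some uncountable `κ`. -/
structure IsBigModel (L : SortedLanguage S) (M : S → Type u) [L.Structure M]
    (κ : Cardinal.{u}) : Prop where
  aleph0_lt : ℵ₀ < κ
  /-- A finitely satisfiable set of formulas in a small tuple of variables over a small set of
  parameters is realised. -/
  saturated : ∀ ⦃ι : Type u⦄ (τ : ι → S) (C : Set (Elem M)), #ι < κ → #C < κ →
    ∀ p : PartialType L τ C,
      (∀ p₀ : PartialType L τ C, p₀ ⊆ p → p₀.Finite → ∃ a : Tuple M τ, Realises a p₀) →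
      ∃ a : Tuple M τ, Realises a p
  /-- Small tuples of the same type are conjugate under an automorphism. -/
  homogeneous : ∀ ⦃ι : Type u⦄ (τ : ι → S), #ι < κ → ∀ a b : Tuple M τ,
    (∀ φ : L.Formula τ, Holds φ a ↔ Holds φ b) →
    ∃ g : Automorphism L M, ∀ i, g.toEquiv (τ i) (a i) = b i

/-! ### Inconsistency pairs and local dividing -/

/-- Pairs `(φ(x̄; ȳ), ψ(ȳ₀, …, ȳₖ₋₁))` of formulas, where `τ` and `υ` are the sorts of the tuples
`x̄` and `ȳ`. -/
structure FormulaPair (L : SortedLanguage S) {X : Type x} {Y : Type y} (τ : X → S) (υ : Y → S)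
    (k : ℕ) where
  φ : L.Formula (Sum.elim τ υ)
  ψ : L.Formula (fun q : Fin k × Y => υ q.2)

namespace FormulaPair

variable [L.Structure M] {X : Type x} {Y : Type y} {τ : X → S} {υ : Y → S} {k : ℕ}

/-- `M ⊨ φ(a; b)`. -/
def Left (P : FormulaPair L τ υ k) (a : Tuple M τ) (b : Tuple M υ) : Prop :=
  Holds P.φ (a.join b)

/-- `M ⊨ ψ(b₀, …, bₖ₋₁)`. -/
def Right (P : FormulaPair L τ υ k) (b : Fin k → Tuple M υ) : Prop :=
  Holds P.ψ (fun q : Fin k × Y => b q.1 q.2)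

/-- `ψ` is a `k`-inconsistency witness for `φ(x̄; ȳ)`. -/
def IsInconsistencyPair (M : S → Type u) [L.Structure M] (P : FormulaPair L τ υ k) : Prop :=
  ¬ ∃ (a : Tuple M τ) (b : Fin k → Tuple M υ), (∀ i, P.Left a (b i)) ∧ P.Right b

/-- `φ(x̄; b)` `(φ, ψ)`-divides over `C`. -/
def Divides (P : FormulaPair L τ υ k) (b : Tuple M υ) (C : Set (Elem M)) : Prop :=
  P.IsInconsistencyPair M ∧
    ∃ c : ℕ → Tuple M υ, (∀ i, Realises (c i) (tp L b C)) ∧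
      ∀ f : Fin k → ℕ, StrictMono f → P.Right (fun i => c (f i))

end FormulaPair

/-- A set of pairs `(φ(x̄; ȳ), ψ(ȳ₀, …, ȳₖ₋₁))` for all possible choices of finite tuples of
variables `x̄` and `ȳ` and of `k < ω`: the members of `Ω τ υ k` are the members of the set for
which `x̄` and `ȳ` have the sorts `τ` and `υ`. -/
abbrev PairSet (L : SortedLanguage S) : Type (max 1 u) :=
  ∀ ⦃X Y : Type⦄ [Finite X] [Finite Y] (τ : X → S) (υ : Y → S) (k : ℕ),
    Set (FormulaPair L τ υ k)

/-- The set `Ξ` of all inconsistency pairs. -/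
def allInconsistencyPairs (L : SortedLanguage S) (M : S → Type u) [L.Structure M] : PairSet L :=
  fun _ _ _ _ _ _ _ => {P | P.IsInconsistencyPair M}

section

variable [L.Structure M]

/-- All members of `Ω` are inconsistency pairs. -/
def IsSetOfInconsistencyPairs (M : S → Type u) [L.Structure M] (Ω : PairSet L) : Prop :=
  ∀ ⦃X Y : Type⦄ [Finite X] [Finite Y] (τ : X → S) (υ : Y → S) (k : ℕ),
    Ω τ υ k ⊆ allInconsistencyPairs L M τ υ k

/-- `Ω` is closed under variable substitution: with `(φ(x̄; ȳ), ψ(ȳ₀, …))` it contains, up to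
equivalence of formulas in `M`, also `(φ(ū; v̄), ψ(v̄₀, …))`. The maps `σ` and `ρ` say which
variable is substituted for which; they need not be injective. -/
def ClosedUnderSubstitution (M : S → Type u) [L.Structure M] (Ω : PairSet L) : Prop :=
  ∀ ⦃X Y X' Y' : Type⦄ [Finite X] [Finite Y] [Finite X'] [Finite Y']
    (τ : X' → S) (υ : Y' → S) (σ : X → X') (ρ : Y → Y') (k : ℕ),
    ∀ P ∈ Ω (τ ∘ σ) (υ ∘ ρ) k, ∃ Q ∈ Ω τ υ k,
      (∀ (a : Tuple M τ) (b : Tuple M υ),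
        Q.Left a b ↔ P.Left (fun i => a (σ i)) (fun j => b (ρ j))) ∧
      (∀ b : Fin k → Tuple M υ, Q.Right b ↔ P.Right (fun i j => b i (ρ j)))

/-- `tp(a/D)` `Ω`-divides over `C`: for some `(φ, ψ) ∈ Ω` it contains a formula `φ(x̄; b)`, with
`b` from `D`, that `(φ, ψ)`-divides over `C`. -/
def TypeDivides (Ω : PairSet L) {X : Type} [Finite X] {τ : X → S} (a : Tuple M τ)
    (D C : Set (Elem M)) : Prop :=
  ∃ (Y : Type) (_ : Finite Y) (υ : Y → S) (k : ℕ), ∃ P ∈ Ω τ υ k,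
    ∃ b : Tuple M υ, b.toSet ⊆ D ∧ P.Left a b ∧ P.Divides b C

/-- `Indep Ω A C B` means that `A` is `Ω`-independent from `B` over `C`: there is no tuple `a`
from `A` such that `tp(a/BC)` `Ω`-divides over `C`. -/
def Indep (Ω : PairSet L) (A C B : Set (Elem M)) : Prop :=
  ∀ ⦃X : Type⦄ [Finite X] (τ : X → S) (a : Tuple M τ), a.toSet ⊆ A →
    ¬ TypeDivides Ω a (B ∪ C) C

/-- `IndepStar Ω κ A C B` means that `A` is `Ω*`-independent from `B` over `C`: for every
(small) `B' ⊇ B` some conjugate of `A` over `BC` is `Ω`-independent from `B'` over `C`. -/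
def IndepStar (Ω : PairSet L) (κ : Cardinal.{u}) (A C B : Set (Elem M)) : Prop :=
  ∀ B' : Set (Elem M), #B' < κ → B ⊆ B' →
    ∃ g : Automorphism L M, (∀ e ∈ B ∪ C, g.apply e = e) ∧ Indep Ω (g.apply '' A) C B'

/-- Transitivity of `Ω`: if `D ⊆ C` and `C` is `Ω`-independent from `b` over `D`, then formulas
`φ(x̄; b)` that `(φ, ψ)`-divide over `D` also `(φ, ψ)`-divide over `C`, for `(φ, ψ) ∈ Ω`. -/
def IsTransitive (M : S → Type u) [L.Structure M] (Ω : PairSet L) (κ : Cardinal.{u}) : Prop :=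
  ∀ ⦃X Y : Type⦄ [Finite X] [Finite Y] (τ : X → S) (υ : Y → S) (k : ℕ),
    ∀ P ∈ Ω τ υ k, ∀ (b : Tuple M υ) (C D : Set (Elem M)), #C < κ → D ⊆ C →
      Indep Ω C D b.toSet → P.Divides b D → P.Divides b C

/-- Normality of `Ω`: if `(φ(x̄, z̄; ȳ), ψ(ȳ₀, …)) ∈ Ω` then, up to equivalence of formulas in `M`,
also `(φ(x̄; z̄, ȳ), ψ(ȳ₀, …) ∧ z̄₀ = ⋯ = z̄ₖ₋₁) ∈ Ω`. -/
def IsNormal (M : S → Type u) [L.Structure M] (Ω : PairSet L) : Prop :=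
  ∀ ⦃X Z Y : Type⦄ [Finite X] [Finite Z] [Finite Y] (τ : X → S) (ζ : Z → S) (υ : Y → S) (k : ℕ),
    ∀ P ∈ Ω (Sum.elim τ ζ) υ k, ∃ Q ∈ Ω τ (Sum.elim ζ υ) k,
      (∀ (a : Tuple M τ) (c : Tuple M ζ) (b : Tuple M υ),
        Q.Left a (c.join b) ↔ P.Left (a.join c) b) ∧
      (∀ (c : Fin k → Tuple M ζ) (b : Fin k → Tuple M υ),
        Q.Right (fun i => (c i).join (b i)) ↔ (P.Right b ∧ ∀ i j, c i = c j))

end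

/-! ### Dividing patterns and local rank -/

/-- Pairs `(φ(x̄; ȳ), ψ(ȳ₀, …, ȳₖ₋₁))`, where `x̄` is a fixed, possibly infinite, tuple of variables
indexed by `ι` with sorts `τ`, and `ȳ` is an arbitrary finite tuple. The finite subtuple of `x̄`
on which `φ` actually depends is the one given by `σ`. -/
structure LocalPair (L : SortedLanguage S) {ι : Type x} (τ : ι → S) where
  {X : Type}
  {Y : Type}
  [finX : Finite X]
  [finY : Finite Y]
  σ : X → ι
  υ : Y → S
  k : ℕ
  pair : FormulaPair L (τ ∘ σ) υ k

attribute [instance] LocalPair.finX LocalPair.finY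

/-- The set `Ω↾x̄` of the members of `Ω` of the form `(φ(x̄; ȳ), ψ)`, with arbitrary `ȳ`. -/
def restrict (Ω : PairSet L) {ι : Type x} (τ : ι → S) : Set (LocalPair L τ) :=
  {P | P.pair ∈ Ω (τ ∘ P.σ) P.υ P.k}

/-- The sequence `ξ = ((φⁱ, ψⁱ))` is a dividing pattern for the partial type `p` over `C`: there
are tuples `bⁱ` such that `p(x̄) ∪ {φⁱ(x̄; bⁱ)}` is consistent (that is, realised in the big model)
and every `φⁱ(x̄; bⁱ)` `(φⁱ, ψⁱ)`-divides over `C ∪ {bʲ : j < i}`. -/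
def IsDividingPattern [L.Structure M] {ι : Type x} {τ : ι → S} {C : Set (Elem M)}
    (p : PartialType L τ C) {I : Type y} [LinearOrder I] (ξ : I → LocalPair L τ) : Prop :=
  ∃ b : ∀ i : I, Tuple M (ξ i).υ,
    (∃ a : Tuple M τ, Realises a p ∧ ∀ i, (ξ i).pair.Left (fun j => a ((ξ i).σ j)) (b i)) ∧
    ∀ i, (ξ i).pair.Divides (b i) (C ∪ ⋃ j < i, (b j).toSet)

/-- The local rank `D_Δ(p) ∈ ω ∪ {∞}`: the greatest length of a finite `Δ`-dividing pattern
for `p`, or `∞` if there are arbitrarily long ones. -/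
noncomputable def localRank [L.Structure M] {ι : Type x} {τ : ι → S} {C : Set (Elem M)}
    (Δ : Set (LocalPair L τ)) (p : PartialType L τ C) : ℕ∞ :=
  ⨆ (n : ℕ) (_ : ∃ ξ : Fin n → LocalPair L τ, (∀ i, ξ i ∈ Δ) ∧ IsDividingPattern p ξ), (n : ℕ∞)

end LocalForking

/-! By homogeneity, `D_Δ(a/C) ≥ n` means that `a` itself realises a `Δ`-dividing pattern of length
`n` over `C` (`le_localRank_tp_iff`). Two operations on such patterns carry the proof. A pattern
over `C` can be moved by an automorphism over `C` to a pattern over any larger small set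
(`HasPattern.exists_map`), since a dividing sequence can be chosen with constant type over that set.
Without moving, a pattern over `C` with parameters in `W` stays one over `CE` whenever `E ⊥_C W`
(`HasPattern.union_of_indep`); this is transitivity of `Ω`. Normality allows the base to be adjoined
on the left of an independence.

(2) ⇒ (1): if no `BC`-conjugate of `a` is independent from `B'` over `C`, compactness yields one
finite `Δ` such that every conjugate satisfies a `Δ`-formula over `B'C` dividing over `C`. Move a
pattern over `BC` to one over `B'C` and put this formula in front: the result has length one more,
over `C`. Equality of ranks brings it back over `BC`, so the rank is infinite.

(3) ⇒ (2): for a pattern of `a` over `C` with parameters `W`, some `aC`-conjugate of `B` is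
independent from `aW` over `C`. The pattern survives over that conjugate, and hence, after
conjugating back, over `BC`.

(1) ⇒ (3): if (3) fails, a finite `Δ` is again responsible. Patterns of `B` over `C` are lengthened
at the front by formulas whose parameters are independent from the old ones. These come from (1),
from existence (`A' ⊥* ∅` over `AC`, the case `B = ∅` of (2) ⇒ (1)) and from left transitivity
(`Indep.trans`). -/

namespace SortedLanguage

variable {S : Type u} {L : SortedLanguage S} {X : Type x} {Y : Type y} {τ : X → S} {υ : Y → S}

/-- Simultaneous substitution of terms for variables, in a term. -/
def Term.subst (f : ∀ i, L.Term υ (τ i)) : ∀ {s : S}, L.Term τ s → L.Term υ s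
  | _, .var i => f i
  | _, .func g ts => .func g (fun i => (ts i).subst f)

/-- Extend a substitution by the identity on bound variables. -/
def Term.liftSubst (f : ∀ i, L.Term υ (τ i)) (Γ : List S) :
    ∀ i : X ⊕ Fin Γ.length, L.Term (Sum.elim υ Γ.get) (Sum.elim τ Γ.get i)
  | .inl i => (f i).subst (fun j => Term.var (τ := Sum.elim υ Γ.get) (.inl j))
  | .inr k => Term.var (τ := Sum.elim υ Γ.get) (.inr k)

/-- Simultaneous substitution of terms for the free variables of a formula. -/
def BoundedFormula.subst (f : ∀ i, L.Term υ (τ i)) :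
    ∀ {Γ : List S}, L.BoundedFormula τ Γ → L.BoundedFormula υ Γ
  | _, .falsum => .falsum
  | Γ, .equal t₁ t₂ => .equal (t₁.subst (Term.liftSubst f Γ)) (t₂.subst (Term.liftSubst f Γ))
  | Γ, .rel R ts => .rel R (fun i => (ts i).subst (Term.liftSubst f Γ))
  | _, .imp φ₁ φ₂ => .imp (φ₁.subst f) (φ₂.subst f)
  | _, .all s φ => .all s (φ.subst f)

end SortedLanguage

namespace LocalForking

open SortedLanguage

variable {S : Type u} {L : SortedLanguage S} {M : S → Type u} [L.Structure M]

/-! ### Substitution and automorphisms -/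

section Basic

variable {X : Type x} {Y : Type y} {τ : X → S} {υ : Y → S}

theorem termValue_subst (f : ∀ i, L.Term υ (τ i)) (v : Tuple M υ) :
    ∀ {s : S} (t : L.Term τ s), termValue v (t.subst f) = termValue (fun i => termValue v (f i)) t
  | _, .var i => rfl
  | _, .func g ts => by
    simp only [Term.subst, termValue]
    congr 1
    funext i
    exact termValue_subst f v (ts i)

theorem termValue_liftSubst (f : ∀ i, L.Term υ (τ i)) (v : Tuple M υ) {Γ : List S}
    (w : Tuple M Γ.get) :
    (fun i => termValue (v.join w) (Term.liftSubst f Γ i)) =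
      Tuple.join (fun i => termValue v (f i)) w := by
  funext i
  cases i with
  | inl i => exact termValue_subst _ _ _
  | inr k => rfl

theorem boundedHolds_subst (f : ∀ i, L.Term υ (τ i)) (v : Tuple M υ) :
    ∀ {Γ : List S} (φ : L.BoundedFormula τ Γ) (w : Tuple M Γ.get),
      boundedHolds v (φ.subst f) w ↔ boundedHolds (fun i => termValue v (f i)) φ w
  | _, .falsum, _ => Iff.rfl
  | _, .equal t₁ t₂, w => by
    simp only [BoundedFormula.subst, boundedHolds, termValue_subst, termValue_liftSubst]
  | _, .rel R ts, w => by
    simp only [BoundedFormula.subst, boundedHolds, termValue_subst, termValue_liftSubst]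
  | _, .imp φ₁ φ₂, w => by
    simp only [BoundedFormula.subst, boundedHolds, boundedHolds_subst f v φ₁,
      boundedHolds_subst f v φ₂]
  | _, .all s φ, w => by
    simp only [BoundedFormula.subst, boundedHolds, boundedHolds_subst f v φ]

/-! ### Automorphisms and invariance of truth. -/

namespace Automorphism

/-- The identity automorphism. -/
def refl (L : SortedLanguage S) (M : S → Type u) [L.Structure M] : Automorphism L M where
  toEquiv _ := Equiv.refl _
  map_fun _ _ := rfl
  map_rel _ _ := Iff.rfl

/-- First `g`, then `h`. -/
def trans (g h : Automorphism L M) : Automorphism L M where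
  toEquiv s := (g.toEquiv s).trans (h.toEquiv s)
  map_fun f a := by simp [g.map_fun, h.map_fun]
  map_rel R a := by
    rw [← g.map_rel R a]
    exact h.map_rel R (fun i => g.toEquiv _ (a i))

/-- The inverse automorphism. -/
def symm (g : Automorphism L M) : Automorphism L M where
  toEquiv s := (g.toEquiv s).symm
  map_fun f a := by
    rw [Equiv.symm_apply_eq, g.map_fun]
    simp
  map_rel R a := by
    rw [← g.map_rel R]
    simp

/-- The action of an automorphism on tuples. -/
def map (g : Automorphism L M) (a : Tuple M τ) : Tuple M τ := fun i => g.toEquiv _ (a i)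

@[simp] theorem symm_map_map (g : Automorphism L M) (a : Tuple M τ) : g.symm.map (g.map a) = a :=
  funext fun _ => (g.toEquiv _).symm_apply_apply _

@[simp] theorem map_symm_map (g : Automorphism L M) (a : Tuple M τ) : g.map (g.symm.map a) = a :=
  funext fun _ => (g.toEquiv _).apply_symm_apply _

@[simp] theorem symm_apply_apply (g : Automorphism L M) (e : Elem M) :
    g.symm.apply (g.apply e) = e :=
  Sigma.ext rfl (heq_of_eq ((g.toEquiv _).symm_apply_apply _))

@[simp] theorem apply_symm_apply (g : Automorphism L M) (e : Elem M) :
    g.apply (g.symm.apply e) = e :=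
  Sigma.ext rfl (heq_of_eq ((g.toEquiv _).apply_symm_apply _))

@[simp] theorem symm_image_image (g : Automorphism L M) (C : Set (Elem M)) :
    g.symm.apply '' (g.apply '' C) = C := by
  simp [Set.image_image]

@[simp] theorem image_symm_image (g : Automorphism L M) (C : Set (Elem M)) :
    g.apply '' (g.symm.apply '' C) = C := by
  simp [Set.image_image]

theorem image_trans (g h : Automorphism L M) (C : Set (Elem M)) :
    (g.trans h).apply '' C = h.apply '' (g.apply '' C) := by
  rw [Set.image_image]; rfl

theorem toSet_map (g : Automorphism L M) (a : Tuple M τ) :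
    (g.map a).toSet = g.apply '' a.toSet :=
  Set.range_comp g.apply (fun i => (⟨τ i, a i⟩ : Elem M))

theorem map_join (g : Automorphism L M) (a : Tuple M τ) (b : Tuple M υ) :
    g.map (a.join b) = (g.map a).join (g.map b) := by
  funext i
  cases i <;> rfl

/-- `g` fixes `C` pointwise. -/
def Fixes (g : Automorphism L M) (C : Set (Elem M)) : Prop := ∀ e ∈ C, g.apply e = e

theorem Fixes.mono {g : Automorphism L M} {C D : Set (Elem M)} (h : g.Fixes D) (hCD : C ⊆ D) :
    g.Fixes C := fun e he => h e (hCD he)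

theorem Fixes.image {g : Automorphism L M} {C : Set (Elem M)} (h : g.Fixes C) :
    g.apply '' C = C := by
  rw [Set.image_congr h, Set.image_id']

theorem Fixes.symm {g : Automorphism L M} {C : Set (Elem M)} (h : g.Fixes C) :
    g.symm.Fixes C := fun e he => by
  conv_lhs => rw [← h e he]
  exact g.symm_apply_apply e

theorem Fixes.trans {g h : Automorphism L M} {C : Set (Elem M)} (hg : g.Fixes C)
    (hh : h.Fixes C) : (g.trans h).Fixes C := fun e he => by
  change h.apply (g.apply e) = e
  rw [hg e he, hh e he]

theorem Fixes.map_eq {g : Automorphism L M} {C : Set (Elem M)} (h : g.Fixes C) {a : Tuple M τ}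
    (ha : a.toSet ⊆ C) : g.map a = a := by
  funext i
  exact eq_of_heq (Sigma.mk.inj (h _ (ha ⟨i, rfl⟩))).2

theorem termValue_map (g : Automorphism L M) (v : Tuple M τ) :
    ∀ {s : S} (t : L.Term τ s), termValue (g.map v) t = g.toEquiv s (termValue v t)
  | _, .var i => rfl
  | _, .func f ts => by
    simp only [termValue, g.map_fun, termValue_map g v]

theorem boundedHolds_map (g : Automorphism L M) (v : Tuple M τ) :
    ∀ {Γ : List S} (φ : L.BoundedFormula τ Γ) (w : Tuple M Γ.get),
      boundedHolds (g.map v) φ (g.map w) ↔ boundedHolds v φ w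
  | _, .falsum, _ => Iff.rfl
  | _, .equal t₁ t₂, w => by
    simp only [boundedHolds, ← map_join, termValue_map, EmbeddingLike.apply_eq_iff_eq]
  | _, .rel R ts, w => by
    simp only [boundedHolds, ← map_join, termValue_map, g.map_rel]
  | _, .imp φ₁ φ₂, w => by
    simp only [boundedHolds, boundedHolds_map g v φ₁, boundedHolds_map g v φ₂]
  | Γ, .all s φ, w => by
    simp only [boundedHolds]
    -- Surjectivity of `g` lets the quantifier range over images only.
    rw [← (g.toEquiv s).forall_congr_right]
    refine forall_congr' fun a => ?_
    rw [← boundedHolds_map g v φ]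
    refine iff_of_eq (congrArg _ (funext fun i => ?_))
    refine Fin.cases ?_ (fun i => ?_) i <;> rfl

theorem holds_map (g : Automorphism L M) (v : Tuple M τ) (φ : L.Formula τ) :
    Holds φ (g.map v) ↔ Holds φ v := by
  rw [Holds, Holds, ← boundedHolds_map g v φ]
  refine iff_of_eq (congrArg _ (funext fun i => i.elim0))

end Automorphism

/-! ### Definable predicates and compactness -/

/-- Every coordinate of `F a` is the value at `a` of a term with parameters in `C`. -/
def TermDef (L : SortedLanguage S) [L.Structure M] (C : Set (Elem M))
    (F : Tuple M τ → Tuple M υ) : Prop :=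
  ∀ j, ∃ t : L.Term (Sum.elim τ (sortsOf C)) (υ j), ∀ a, termValue (a.join (enum C)) t = F a j

/-- The predicate `R` is defined by a formula with parameters in `C`. -/
def ParamDef (L : SortedLanguage S) [L.Structure M] (C : Set (Elem M))
    (R : Tuple M τ → Prop) : Prop :=
  ∃ φ : L.Formula (Sum.elim τ (sortsOf C)), ∀ a, Holds φ (a.join (enum C)) ↔ R a

theorem TermDef.join {Z : Type*} {ζ : Z → S} {C : Set (Elem M)} {F : Tuple M τ → Tuple M υ}
    {G : Tuple M τ → Tuple M ζ} (hF : TermDef L C F) (hG : TermDef L C G) :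
    TermDef L C (fun a => (F a).join (G a)) := fun j =>
  match j with
  | .inl j => hF j
  | .inr j => hG j

theorem TermDef.const {C : Set (Elem M)} {b : Tuple M υ} (hb : b.toSet ⊆ C) :
    TermDef L C (fun _ : Tuple M τ => b) := fun j =>
  ⟨Term.var (τ := Sum.elim τ (sortsOf C)) (.inr ⟨⟨υ j, b j⟩, hb ⟨j, rfl⟩⟩), fun _ => rfl⟩

theorem TermDef.proj {C : Set (Elem M)} (σ : Y → X) :
    TermDef L C (fun (a : Tuple M τ) j => a (σ j) : Tuple M τ → Tuple M (τ ∘ σ)) := fun j =>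
  ⟨Term.var (τ := Sum.elim τ (sortsOf C)) (.inl (σ j)), fun _ => rfl⟩

theorem toSet_enum (C : Set (Elem M)) : (enum C).toSet = C := Subtype.range_val

theorem paramDef_holds {C : Set (Elem M)} {F : Tuple M τ → Tuple M υ} (hF : TermDef L C F)
    (φ : L.Formula υ) : ParamDef L C (fun a => Holds φ (F a)) := by
  choose t ht using hF
  refine ⟨BoundedFormula.subst t φ, fun a => ?_⟩
  rw [Holds, boundedHolds_subst]
  simp only [ht]
  rfl

theorem ParamDef.comp {C D : Set (Elem M)} (hDC : D ⊆ C) {R : Tuple M υ → Prop}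
    (hR : ParamDef L D R) {F : Tuple M τ → Tuple M υ} (hF : TermDef L C F) :
    ParamDef L C (fun a => R (F a)) := by
  obtain ⟨φ, hφ⟩ := hR
  simp only [← hφ]
  exact paramDef_holds (hF.join (TermDef.const ((toSet_enum D).trans_subset hDC))) φ

theorem ParamDef.imp {C : Set (Elem M)} {R R' : Tuple M τ → Prop} (hR : ParamDef L C R)
    (hR' : ParamDef L C R') : ParamDef L C (fun a => R a → R' a) := by
  obtain ⟨φ, hφ⟩ := hR
  obtain ⟨φ', hφ'⟩ := hR'
  exact ⟨.imp φ φ', fun a => imp_congr (hφ a) (hφ' a)⟩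

theorem ParamDef.not {C : Set (Elem M)} {R : Tuple M τ → Prop} (hR : ParamDef L C R) :
    ParamDef L C (fun a => ¬ R a) :=
  hR.imp ⟨.falsum, fun _ => Iff.rfl⟩

/-- Passing to definable predicates makes types independent of how formulas and parameters are
indexed, so changes of variables and of base become compositions. -/
theorem realises_tp_iff {C : Set (Elem M)} {a b : Tuple M τ} :
    Realises a (tp L b C) ↔ ∀ R : Tuple M τ → Prop, ParamDef L C R → R b → R a := by
  refine ⟨fun h R ⟨φ, hφ⟩ hb => (hφ a).1 (h φ ((hφ b).2 hb)), fun h φ hφ => ?_⟩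
  exact h (fun a => Holds φ (a.join (enum C))) ⟨φ, fun _ => Iff.rfl⟩ hφ

theorem Realises.comp {C D : Set (Elem M)} (hDC : D ⊆ C) {a b : Tuple M τ}
    (h : Realises a (tp L b C)) {F : Tuple M τ → Tuple M υ} (hF : TermDef L C F) :
    Realises (F a) (tp L (F b) D) :=
  realises_tp_iff.2 fun _ hR hb => realises_tp_iff.1 h _ (hR.comp hDC hF) hb

theorem Realises.mono {C D : Set (Elem M)} (hDC : D ⊆ C) {a b : Tuple M τ}
    (h : Realises a (tp L b C)) : Realises a (tp L b D) :=
  h.comp hDC (TermDef.proj id)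

theorem Realises.symm {C : Set (Elem M)} {a b : Tuple M τ}
    (h : Realises a (tp L b C)) : Realises b (tp L a C) :=
  realises_tp_iff.2 fun _ hR ha => by_contra fun hb => realises_tp_iff.1 h _ hR.not hb ha

theorem Realises.map {C : Set (Elem M)} {a b : Tuple M τ} (h : Realises a (tp L b C))
    (g : Automorphism L M) : Realises (g.map a) (tp L (g.map b) (g.apply '' C)) := by
  -- The image of `C` carries its own indexing; pulled back along `g`, its enumeration is a tuple of
  -- parameters from `C`.
  have key : ∀ c : Tuple M τ, (g.map c).join (enum (g.apply '' C)) =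
      g.map (c.join (g.symm.map (enum (g.apply '' C)))) := fun c => by
    rw [Automorphism.map_join, Automorphism.map_symm_map]
  have hdef : TermDef L C
      (fun c : Tuple M τ => Tuple.join c (g.symm.map (enum (g.apply '' C)))) :=
    (TermDef.proj id).join (TermDef.const (by
      rw [Automorphism.toSet_map, toSet_enum, Automorphism.symm_image_image]))
  intro φ hφ
  change Holds φ _ at hφ
  rw [key, Automorphism.holds_map] at hφ ⊢
  exact realises_tp_iff.1 h _ (paramDef_holds hdef φ) hφ

theorem realises_map_of_fixes {C : Set (Elem M)} {g : Automorphism L M} (hg : g.Fixes C)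
    (a : Tuple M τ) : Realises (g.map a) (tp L a C) := by
  intro φ hφ
  have h := (g.holds_map _ φ).2 hφ
  rwa [Automorphism.map_join, hg.map_eq (toSet_enum C).subset] at h

end Basic

/-! ### Homogeneity and saturation over small sets of parameters. -/

section BigModel

variable {κ : Cardinal.{u}}

theorem add_lt (hM : IsBigModel L M κ) {α β : Type u} (hα : #α < κ) (hβ : #β < κ) :
    #(α ⊕ β) < κ := by
  rw [← add_def]
  exact add_lt_of_lt hM.aleph0_lt.le hα hβ

theorem union_lt (hM : IsBigModel L M κ) {A B : Set (Elem M)} (hA : #A < κ) (hB : #B < κ) :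
    #(A ∪ B : Set (Elem M)) < κ :=
  (mk_union_le A B).trans_lt (add_lt_of_lt hM.aleph0_lt.le hA hB)

theorem finite_lt (hM : IsBigModel L M κ) {A : Set (Elem M)} (hA : A.Finite) : #A < κ :=
  hA.lt_aleph0.trans hM.aleph0_lt

/-- Homogeneity is applied to the tuple extended by an enumeration of `C`. -/
theorem exists_automorphism (hM : IsBigModel L M κ) {ι : Type u} {τ : ι → S}
    (hι : #ι < κ) {C : Set (Elem M)} (hC : #C < κ) {a b : Tuple M τ} (h : Realises b (tp L a C)) :
    ∃ g : Automorphism L M, g.Fixes C ∧ g.map a = b := by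
  obtain ⟨g, hg⟩ := hM.homogeneous (Sum.elim τ (sortsOf C)) (add_lt hM hι hC)
    (a.join (enum C)) (b.join (enum C)) (fun φ => ⟨fun hφ => h φ hφ, fun hφ => h.symm φ hφ⟩)
  exact ⟨g, fun e he => Sigma.ext rfl (heq_of_eq (hg (.inr ⟨e, he⟩))),
    funext fun i => hg (.inl i)⟩

theorem exists_automorphism_of_finite (hM : IsBigModel L M κ) {Y : Type} [Finite Y]
    {υ : Y → S} {C : Set (Elem M)} (hC : #C < κ) {a b : Tuple M υ} (h : Realises b (tp L a C)) :
    ∃ g : Automorphism L M, g.Fixes C ∧ g.map a = b := by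
  obtain ⟨g, hg, hab⟩ := exists_automorphism hM ((mk_lt_aleph0 (α := ULift.{u} Y)).trans
    hM.aleph0_lt) hC (h.comp subset_rfl (TermDef.proj ULift.down))
  exact ⟨g, hg, funext fun i => congrFun hab ⟨i⟩⟩

/-- Compactness: a set of definable conditions is satisfiable if it follows from a `base` and
conditions `q`, finitely many of which are always satisfiable together with `base`. -/
theorem exists_of_finite_approx (hM : IsBigModel L M κ) {ι : Type u} {τ : ι → S}
    (hι : #ι < κ) {C : Set (Elem M)} (hC : #C < κ) {T : Type*} (U : Set T) (base : Tuple M τ → Prop) (q : T → Tuple M τ → Prop)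
    (hfin : ∀ t ⊆ U, t.Finite → ∃ a, base a ∧ ∀ x ∈ t, q x a)
    (𝓡 : Set (Tuple M τ → Prop)) (hdef : ∀ R ∈ 𝓡, ParamDef L C R)
    (h : ∀ R ∈ 𝓡, (∀ a, base a → R a) ∨ ∃ x ∈ U, ∀ a, base a → q x a → R a) :
    ∃ a, ∀ R ∈ 𝓡, R a := by
  obtain ⟨a, ha⟩ := hM.saturated τ C hι hC
    {φ | (fun a : Tuple M τ => Holds φ (a.join (enum C))) ∈ 𝓡} (fun p₀ hp₀ hfp₀ => by
      -- Each formula depends on at most one condition `q x`, so a finite part of the type depends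
      -- on finitely many.
      have h' : ∀ φ ∈ p₀, ∃ t ⊆ U, t.Finite ∧
          ∀ a : Tuple M τ, base a → (∀ x ∈ t, q x a) → Holds φ (a.join (enum C)) := by
        intro φ hφ
        rcases h _ (hp₀ hφ) with h | ⟨x, hx, h⟩
        · exact ⟨∅, Set.empty_subset _, Set.finite_empty, fun a ha _ => h a ha⟩
        · exact ⟨{x}, Set.singleton_subset_iff.2 hx, Set.finite_singleton _,
            fun a ha hq => h a ha (hq x rfl)⟩
      choose! t htU htf ht using h'
      obtain ⟨a, ha, hq⟩ := hfin (⋃ φ ∈ p₀, t φ) (Set.iUnion₂_subset htU) (hfp₀.biUnion htf)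
      exact ⟨a, fun φ hφ => ht φ hφ a ha fun x hx => hq x (Set.mem_biUnion hφ hx)⟩)
  refine ⟨a, fun R hR => ?_⟩
  obtain ⟨φ, hφ⟩ := hdef R hR
  refine (hφ a).1 (ha φ ?_)
  have : (fun a : Tuple M τ => Holds φ (a.join (enum C))) = R := funext fun a => propext (hφ a)
  rw [Set.mem_ofPred_eq, this]
  exact hR

end BigModel

/-! ### Dividing -/

namespace FormulaPair

variable {X : Type x} {Y : Type y} {τ : X → S} {υ : Y → S} {k : ℕ} {P : FormulaPair L τ υ k}

theorem left_map (P : FormulaPair L τ υ k) (g : Automorphism L M) (a : Tuple M τ)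
    (b : Tuple M υ) : P.Left (g.map a) (g.map b) ↔ P.Left a b := by
  rw [Left, ← Automorphism.map_join, Automorphism.holds_map]
  rfl

theorem right_map (P : FormulaPair L τ υ k) (g : Automorphism L M) (b : Fin k → Tuple M υ) :
    P.Right (fun i => g.map (b i)) ↔ P.Right b :=
  g.holds_map (fun q : Fin k × Y => b q.1 q.2) P.ψ

theorem Divides.mono {b : Tuple M υ} {C D : Set (Elem M)} (hDC : D ⊆ C) (h : P.Divides b C) :
    P.Divides b D :=
  ⟨h.1, h.2.imp fun _ hc => ⟨fun i => (hc.1 i).mono hDC, hc.2⟩⟩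

theorem Divides.map {b : Tuple M υ} {C : Set (Elem M)} (h : P.Divides b C)
    (g : Automorphism L M) : P.Divides (g.map b) (g.apply '' C) := by
  obtain ⟨hP, c, hc, hr⟩ := h
  exact ⟨hP, fun i => g.map (c i), fun i => (hc i).map g,
    fun f hf => (P.right_map g _).2 (hr f hf)⟩

/-- Pigeonhole: finitely many predicates have finitely many joint truth patterns, one of which
occurs infinitely often. Ramsey's theorem is not needed, since only the types of single members are
made constant. -/
theorem exists_strictMono_homogeneous {α : Type*} (c : ℕ → α) {T : Type*} (R : T → α → Prop)
    {t : Set T} (ht : t.Finite) :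
    ∃ e : ℕ → ℕ, StrictMono e ∧ ∀ x ∈ t, ∀ m n, R x (c (e m)) → R x (c (e n)) := by
  have := ht.to_subtype
  obtain ⟨y, hy⟩ := Finite.exists_infinite_fiber (fun (m : ℕ) (x : t) => R x (c m))
  have hinf : Set.Infinite ((fun (m : ℕ) (x : t) => R x (c m)) ⁻¹' {y}) :=
    Set.infinite_coe_iff.1 hy
  refine ⟨fun m => Nat.nth (· ∈ (fun (m : ℕ) (x : t) => R x (c m)) ⁻¹' {y}) m,
    Nat.nth_strictMono hinf, fun x hx m n h => ?_⟩
  have hm := congrFun (Nat.nth_mem_of_infinite hinf m) ⟨x, hx⟩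
  have hn := congrFun (Nat.nth_mem_of_infinite hinf n) ⟨x, hx⟩
  exact (iff_of_eq (hm.trans hn.symm)).1 h

/-- A formula dividing over `C` has a `C`-conjugate that divides over a given larger set `D`. -/
theorem Divides.exists_map {κ : Cardinal.{u}} (hM : IsBigModel L M κ) {X Y : Type} [Finite Y]
    {τ : X → S} {υ : Y → S} {P : FormulaPair L τ υ k} {b : Tuple M υ} {C D : Set (Elem M)}
    (hD : #D < κ) (hCD : C ⊆ D) (h : P.Divides b C) :
    ∃ g : Automorphism L M, g.Fixes C ∧ P.Divides (g.map b) D := by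
  obtain ⟨hP, c, hc, hr⟩ := h
  -- The sought sequence is treated as one countable tuple, its members being the rows.
  let τ' : ULift.{u} (ℕ × Y) → S := fun q => υ q.down.2
  let row : ℕ → Tuple M τ' → Tuple M υ := fun m a j => a ⟨(m, j)⟩
  have hrow : ∀ m (E : Set (Elem M)), TermDef L E (row m) := fun m E =>
    TermDef.proj (τ := τ') (fun j => ⟨(m, j)⟩)
  have hι : #(ULift.{u} (ℕ × Y)) < κ := by
    have : Countable Y := Finite.to_countable
    exact mk_le_aleph0.trans_lt hM.aleph0_lt
  -- Subsequences of `c` are the approximations: they keep `ψ` and the type over `C`, and can be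
  -- made homogeneous for finitely many formulas over `D`.
  obtain ⟨a, ha⟩ := exists_of_finite_approx hM (τ := τ') hι hD
    (Set.univ : Set (L.Formula (Sum.elim υ (sortsOf D))))
    (fun a => ∃ e : ℕ → ℕ, StrictMono e ∧ ∀ m, row m a = c (e m))
    (fun θ a => ∀ m n, Holds θ ((row m a).join (enum D)) → Holds θ ((row n a).join (enum D)))
    (fun t _ ht => by
      obtain ⟨e, he, hR⟩ := exists_strictMono_homogeneous c
        (fun (θ : L.Formula (Sum.elim υ (sortsOf D))) b => Holds θ (b.join (enum D))) ht
      exact ⟨fun q => c (e q.down.1) q.down.2, ⟨e, he, fun _ => rfl⟩, hR⟩)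
    ({R | ∃ m, ∃ θ ∈ tp L b C, R = fun a => Holds θ ((row m a).join (enum C))} ∪
      {R | ∃ f : Fin k → ℕ, StrictMono f ∧ R = fun a => P.Right (fun i => row (f i) a)} ∪
      {R | ∃ (θ : L.Formula (Sum.elim υ (sortsOf D))) (m n : ℕ), R = fun a =>
        Holds θ ((row m a).join (enum D)) → Holds θ ((row n a).join (enum D))})
    (by
      rintro R ((⟨m, θ, -, rfl⟩ | ⟨f, -, rfl⟩) | ⟨θ, m, n, rfl⟩)
      · exact paramDef_holds
          ((hrow m D).join (TermDef.const ((toSet_enum C).trans_subset hCD))) θ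
      · exact paramDef_holds (TermDef.proj (τ := τ')
          (fun q : Fin k × Y => (⟨(f q.1, q.2)⟩ : ULift.{u} (ℕ × Y)))) P.ψ
      · exact (paramDef_holds ((hrow m D).join (TermDef.const (toSet_enum D).subset)) θ).imp
          (paramDef_holds ((hrow n D).join (TermDef.const (toSet_enum D).subset)) θ))
    (by
      rintro R ((⟨m, θ, hθ, rfl⟩ | ⟨f, hf, rfl⟩) | ⟨θ, m, n, rfl⟩)
      · left
        rintro a ⟨e, -, ha⟩
        rw [ha]
        exact hc _ θ hθ
      · left
        rintro a ⟨e, he, ha⟩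
        simp only [ha]
        exact hr _ (he.comp hf)
      · exact .inr ⟨θ, trivial, fun a _ h => h m n⟩)
  have htp : ∀ m n, Realises (row n a) (tp L (row m a) D) := fun m n θ hθ =>
    ha _ (.inr ⟨θ, m, n, rfl⟩) hθ
  have hb : Realises (row 0 a) (tp L b C) := fun θ hθ => ha _ (.inl (.inl ⟨0, θ, hθ, rfl⟩))
  -- All rows have the type of row `0` over `D`, so the conjugate of `b` to be taken is row `0`.
  obtain ⟨g, hg, hgb⟩ := exists_automorphism_of_finite hM ((mk_le_mk_of_subset hCD).trans_lt hD) hb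
  refine ⟨g, hg, hP, fun m => row m a, fun m => hgb ▸ htp 0 m, fun f hf => ?_⟩
  exact ha _ (.inl (.inr ⟨f, hf, rfl⟩))

end FormulaPair

/-! ### Independence -/

section Indep

variable {Ω : PairSet L} {A B C D E : Set (Elem M)}

theorem Indep.mono {A' B' : Set (Elem M)} (h : Indep Ω A C B) (hA : A' ⊆ A)
    (hB : B' ⊆ B ∪ C) : Indep Ω A' C B' := by
  rintro X _ τ a ha ⟨Y, hY, υ, k, P, hP, b, hb, hl, hd⟩
  exact h τ a (ha.trans hA)
    ⟨Y, hY, υ, k, P, hP, b, hb.trans (Set.union_subset hB Set.subset_union_right), hl, hd⟩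

/-- Dividing over the larger base `D` implies dividing over `C`. -/
theorem Indep.mono_base (h : Indep Ω A C B) (hCD : C ⊆ D) (hD : D ⊆ B ∪ C) :
    Indep Ω A D B := by
  rintro X _ τ a ha ⟨Y, hY, υ, k, P, hP, b, hb, hl, hd⟩
  exact h τ a ha ⟨Y, hY, υ, k, P, hP, b,
    hb.trans (Set.union_subset Set.subset_union_left hD), hl, hd.mono hCD⟩

theorem Indep.map (h : Indep Ω A C B) (g : Automorphism L M) :
    Indep Ω (g.apply '' A) (g.apply '' C) (g.apply '' B) := by
  rintro X _ τ a ha ⟨Y, hY, υ, k, P, hP, b, hb, hl, hd⟩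
  refine h τ (g.symm.map a) ?_
    ⟨Y, hY, υ, k, P, hP, g.symm.map b, ?_, (P.left_map g.symm a b).2 hl, ?_⟩
  · simpa [Automorphism.toSet_map] using Set.image_mono (f := g.symm.apply) ha
  · simpa [Automorphism.toSet_map, Set.image_union] using Set.image_mono (f := g.symm.apply) hb
  · simpa using hd.map g.symm

theorem exists_mem_of_reindex (hsubst : ClosedUnderSubstitution M Ω)
    {X Y X' : Type} [Finite X] [Finite Y] [Finite X'] {τ : X → S} {τ' : X' → S} {υ : Y → S}
    {k : ℕ} {P : FormulaPair L τ υ k} (hP : P ∈ Ω τ υ k) (σ : X → X') (hσ : τ' ∘ σ = τ) :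
    ∃ Q ∈ Ω τ' υ k,
      (∀ (a : Tuple M τ) (a' : Tuple M τ'),
        (∀ i, (⟨τ' (σ i), a' (σ i)⟩ : Elem M) = ⟨τ i, a i⟩) →
          ∀ b, Q.Left a' b ↔ P.Left a b) ∧
      ∀ b : Fin k → Tuple M υ, Q.Right b ↔ P.Right b := by
  subst hσ
  obtain ⟨Q, hQ, hl, hr⟩ := hsubst τ' υ σ id k P hP
  refine ⟨Q, hQ, fun a a' haa' b => ?_, hr⟩
  rw [hl]
  have : (fun i => a' (σ i)) = a := funext fun i => eq_of_heq (Sigma.mk.inj (haa' i)).2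
  rw [this]
  rfl

/-- Split a tuple from `A ∪ C` into parts from `A` and `C`. Normality moves the second part to the
parameter side, where it preserves dividing over `C`. -/
theorem Indep.union_base (hΞ : IsSetOfInconsistencyPairs M Ω)
    (hsubst : ClosedUnderSubstitution M Ω) (hnormal : IsNormal M Ω) (h : Indep Ω A C B) :
    Indep Ω (A ∪ C) C B := by
  classical
  rintro X _ τ a ha ⟨Y, hY, υ, k, P, hP, b, hb, hl, hd⟩
  let p : X → Prop := fun i => (⟨τ i, a i⟩ : Elem M) ∈ A
  let e := Equiv.sumCompl p
  let τ₁ : {i // p i} → S := fun i => τ i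
  let τ₂ : {i // ¬ p i} → S := fun i => τ i
  let a₁ : Tuple M τ₁ := fun i => a i
  let a₂ : Tuple M τ₂ := fun i => a i
  have he : ∀ z : {i // p i} ⊕ {i // ¬ p i},
      (⟨Sum.elim τ₁ τ₂ z, a₁.join a₂ z⟩ : Elem M) = ⟨τ (e z), a (e z)⟩ := by
    rintro (z | z) <;> rfl
  have hτ : Sum.elim τ₁ τ₂ ∘ e.symm = τ := funext fun i => by
    have := congrArg Sigma.fst (he (e.symm i))
    simpa using this
  obtain ⟨Q, hQ, hQl, hQr⟩ := exists_mem_of_reindex hsubst hP e.symm hτ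
  obtain ⟨Q', hQ', hl', hr'⟩ := hnormal τ₁ τ₂ υ k Q hQ
  have ha₂ : a₂.toSet ⊆ C := by
    rintro _ ⟨i, rfl⟩
    exact (ha ⟨i.1, rfl⟩).resolve_left i.2
  refine h τ₁ a₁ (by rintro _ ⟨i, rfl⟩; exact i.2)
    ⟨_, inferInstance, _, k, Q', hQ', a₂.join b, ?_, ?_, hΞ _ _ _ hQ', ?_⟩
  · rintro _ ⟨i | i, rfl⟩
    · exact .inr (ha₂ ⟨i, rfl⟩)
    · exact hb ⟨i, rfl⟩
  · rw [hl', hQl a (a₁.join a₂) fun i => by rw [he, Equiv.apply_symm_apply]]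
    exact hl
  · obtain ⟨-, c, hc, hr⟩ := hd
    -- As `a₂` lies in `C`, it can be repeated unchanged along the sequence, which satisfies the
    -- added equalities.
    refine ⟨fun m => a₂.join (c m), fun m => ?_, fun f hf => ?_⟩
    · exact (hc m).comp subset_rfl ((TermDef.const ha₂).join (TermDef.proj id))
    · exact (hr' (fun _ => a₂) _).2 ⟨(hQr _).2 (hr f hf), fun _ _ => rfl⟩

/-- Since `CA` is independent from `b` over `C`, a formula with parameters `b` dividing over `C`
still divides over `CA`, where the second independence excludes it. -/
theorem Indep.trans {κ : Cardinal.{u}} (hM : IsBigModel L M κ)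
    (hΞ : IsSetOfInconsistencyPairs M Ω) (hsubst : ClosedUnderSubstitution M Ω)
    (htrans : IsTransitive M Ω κ) (hnormal : IsNormal M Ω) (hA : #A < κ) (hC : #C < κ)
    (h : Indep Ω A C B) (h' : Indep Ω E (C ∪ A) B) : Indep Ω (A ∪ E) C B := by
  have h1 := h.union_base hΞ hsubst hnormal
  have h2 := h'.union_base hΞ hsubst hnormal
  rintro X _ τ a ha ⟨Y, hY, υ, k, P, hP, b, hb, hl, hd⟩
  refine h2 τ a (ha.trans ?_) ⟨Y, hY, υ, k, P, hP, b, hb.trans ?_, hl,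
    htrans τ υ k P hP b (C ∪ A) C (union_lt hM hC hA) Set.subset_union_left
      (h1.mono (Set.union_comm C A).subset hb) hd⟩
  · grind
  · grind

end Indep

/-! ### Dividing patterns -/

section Pattern

variable {ι : Type x} {τ : ι → S}

/-- The recursive form of dividing patterns: there is a `Δ`-dividing pattern of length `n` over
`D`, realised by `a`, with parameters in `W`. -/
def HasPattern (Δ : Set (LocalPair L τ)) (a : Tuple M τ) (W : Set (Elem M)) :
    ℕ → Set (Elem M) → Prop
  | 0, _ => True
  | n + 1, D => ∃ P ∈ Δ, ∃ b : Tuple M P.υ, b.toSet ⊆ W ∧ P.pair.Left (fun j => a (P.σ j)) b ∧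
      P.pair.Divides b D ∧ HasPattern Δ a W n (D ∪ b.toSet)

variable {Δ : Set (LocalPair L τ)} {a : Tuple M τ} {W C D : Set (Elem M)}

theorem HasPattern.mono {W' : Set (Elem M)} (hW : W ⊆ W') :
    ∀ {n : ℕ} {C D : Set (Elem M)}, D ⊆ C → HasPattern Δ a W n C → HasPattern Δ a W' n D
  | 0, _, _, _, _ => trivial
  | _ + 1, _, _, hDC, ⟨P, hP, b, hb, hl, hd, h⟩ =>
    ⟨P, hP, b, hb.trans hW, hl, hd.mono hDC, h.mono hW (Set.union_subset_union_left _ hDC)⟩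

theorem HasPattern.of_succ : ∀ {n : ℕ} {D : Set (Elem M)},
    HasPattern Δ a W (n + 1) D → HasPattern Δ a W n D
  | 0, _, _ => trivial
  | _ + 1, _, ⟨P, hP, b, hb, hl, hd, h⟩ => ⟨P, hP, b, hb, hl, hd, h.of_succ⟩

theorem HasPattern.of_le {m n : ℕ} (hmn : m ≤ n) (h : HasPattern Δ a W n D) :
    HasPattern Δ a W m D := by
  induction hmn with
  | refl => exact h
  | step _ ih => exact ih h.of_succ

theorem HasPattern.map (g : Automorphism L M) : ∀ {n : ℕ} {D : Set (Elem M)},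
    HasPattern Δ a W n D → HasPattern Δ (g.map a) (g.apply '' W) n (g.apply '' D)
  | 0, _, _ => trivial
  | _ + 1, _, ⟨P, hP, b, hb, hl, hd, h⟩ =>
    ⟨P, hP, g.map b, (g.toSet_map b).trans_subset (Set.image_mono hb),
      (P.pair.left_map g _ _).2 hl, hd.map g, by
        rw [g.toSet_map, ← Set.image_union]
        exact h.map g⟩

theorem toSet_finite {Y : Type} [Finite Y] {υ : Y → S} (b : Tuple M υ) : b.toSet.Finite :=
  Set.finite_range _

theorem HasPattern.exists_finite : ∀ {n : ℕ} {D : Set (Elem M)}, HasPattern Δ a W n D →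
    ∃ W' : Set (Elem M), W'.Finite ∧ HasPattern Δ a W' n D
  | 0, _, _ => ⟨∅, Set.finite_empty, trivial⟩
  | _ + 1, _, ⟨P, hP, b, _, hl, hd, h⟩ => by
    obtain ⟨W', hW', h'⟩ := h.exists_finite
    exact ⟨b.toSet ∪ W', (toSet_finite b).union hW', P, hP, b, Set.subset_union_left, hl, hd,
      h'.mono Set.subset_union_right subset_rfl⟩

/-- A pattern over `C` has a `C`-conjugate type realised together with a pattern over a given
larger set `D`. -/
theorem HasPattern.exists_map {κ : Cardinal.{u}} (hM : IsBigModel L M κ) :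
    ∀ {n : ℕ} {a : Tuple M τ} {C D : Set (Elem M)}, #D < κ → C ⊆ D →
      HasPattern Δ a Set.univ n C →
        ∃ g : Automorphism L M, g.Fixes C ∧ HasPattern Δ (g.map a) Set.univ n D
  | 0, _, _, _, _, _, _ => ⟨.refl L M, fun _ _ => rfl, trivial⟩
  | n + 1, a, C, D, hD, hCD, ⟨P, hP, b, _, hl, hd, h⟩ => by
    -- First move the leading formula so that it divides over `D`; then move the rest, keeping the
    -- new parameters fixed.
    obtain ⟨g, hg, hgd⟩ := hd.exists_map hM hD hCD
    have h' := h.map g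
    rw [Set.image_union, hg.image, ← g.toSet_map] at h'
    obtain ⟨f, hf, hfd⟩ := (h'.mono (Set.subset_univ _) subset_rfl).exists_map hM
      (D := D ∪ (g.map b).toSet) (union_lt hM hD (finite_lt hM (toSet_finite _)))
      (Set.union_subset_union_left _ hCD)
    refine ⟨g.trans f, hg.trans (hf.mono Set.subset_union_left), P, hP, g.map b,
      Set.subset_univ _, ?_, hgd, hfd⟩
    have := (P.pair.left_map f _ _).2 ((P.pair.left_map g _ _).2 hl)
    rwa [hf.map_eq (a := g.map b) Set.subset_union_right] at this

/-- A pattern over `D` remains one over a larger set independent from its parameters. -/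
theorem HasPattern.union_of_indep {κ : Cardinal.{u}} (hM : IsBigModel L M κ) {Ω : PairSet L}
    (hΞ : IsSetOfInconsistencyPairs M Ω) (hsubst : ClosedUnderSubstitution M Ω)
    (htrans : IsTransitive M Ω κ) (hnormal : IsNormal M Ω) (hΔ : Δ ⊆ restrict Ω τ)
    {E : Set (Elem M)} (hE : #E < κ) :
    ∀ {n : ℕ} {D : Set (Elem M)}, #D < κ → Indep Ω E D W → HasPattern Δ a W n D →
      HasPattern Δ a W n (D ∪ E)
  | 0, _, _, _, _ => trivial
  | _ + 1, D, hD, hi, ⟨P, hP, b, hb, hl, hd, h⟩ => by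
    refine ⟨P, hP, b, hb, hl, ?_, ?_⟩
    · exact htrans _ _ _ P.pair (hΔ hP) b (D ∪ E) D (union_lt hM hD hE) Set.subset_union_left
        ((hi.union_base hΞ hsubst hnormal).mono (Set.union_comm D E).subset
          (hb.trans Set.subset_union_left)) hd
    -- The tail has base `D ∪ b`; as `b` lies in `W`, base monotonicity keeps `E` independent from
    -- `W`.
    · have := h.union_of_indep hM hΞ hsubst htrans hnormal hΔ hE
        (union_lt hM hD (finite_lt hM (toSet_finite b)))
        (hi.mono_base Set.subset_union_left (by grind))
      rwa [Set.union_right_comm] at this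

/-- Realised dividing patterns in the sense of `IsDividingPattern`. -/
theorem hasPattern_iff : ∀ {n : ℕ} {D : Set (Elem M)}, HasPattern Δ a Set.univ n D ↔
    ∃ ξ : Fin n → LocalPair L τ, (∀ i, ξ i ∈ Δ) ∧ ∃ b : ∀ i, Tuple M (ξ i).υ,
      (∀ i, (ξ i).pair.Left (fun j => a ((ξ i).σ j)) (b i)) ∧
      ∀ i, (ξ i).pair.Divides (b i) (D ∪ ⋃ j < i, (b j).toSet)
  | 0, _ => ⟨fun _ => ⟨fun i => i.elim0, fun i => i.elim0, fun i => i.elim0, fun i => i.elim0,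
      fun i => i.elim0⟩, fun _ => trivial⟩
  | n + 1, D => by
    constructor
    · rintro ⟨P, hP, b, -, hl, hd, h⟩
      obtain ⟨ξ, hξ, c, hcl, hcd⟩ := hasPattern_iff.1 h
      let ξ' : Fin (n + 1) → LocalPair L τ := Fin.cons P ξ
      let b' : ∀ i, Tuple M (ξ' i).υ := @Fin.cons n (fun i => Tuple M (ξ' i).υ) b c
      refine ⟨ξ', fun i => ?_, b', fun i => ?_, fun i => ?_⟩
      · cases i using Fin.cases with
        | zero => exact hP
        | succ i => exact hξ i
      · cases i using Fin.cases with
        | zero => exact hl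
        | succ i => exact hcl i
      · cases i using Fin.cases with
        | zero => exact hd.mono (Set.union_subset subset_rfl (Set.iUnion₂_subset
            fun j hj => absurd hj (Fin.not_lt_zero j)))
        | succ i =>
          refine (hcd i).mono (Set.union_subset (by grind) (Set.iUnion₂_subset fun j hj => ?_))
          cases j using Fin.cases with
          | zero => exact Set.subset_union_right.trans Set.subset_union_left
          | succ j =>
            exact fun e he => .inr (Set.mem_iUnion₂.2 ⟨j, Fin.succ_lt_succ_iff.1 hj, he⟩)
    · rintro ⟨ξ, hξ, b, hl, hd⟩
      refine ⟨ξ 0, hξ 0, b 0, Set.subset_univ _, hl 0, (hd 0).mono Set.subset_union_left,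
        hasPattern_iff.2 ⟨fun i => ξ i.succ, fun i => hξ _, fun i => b i.succ, fun i => hl _,
          fun i => (hd i.succ).mono ?_⟩⟩
      refine Set.union_subset (Set.union_subset Set.subset_union_left ?_)
        (Set.iUnion₂_subset fun j hj => ?_)
      · exact fun e he => .inr (Set.mem_iUnion₂.2 ⟨0, Fin.succ_pos i, he⟩)
      · exact fun e he => .inr (Set.mem_iUnion₂.2 ⟨j.succ, Fin.succ_lt_succ_iff.2 hj, he⟩)

end Pattern

/-! ### Local rank and independence -/

section Rank

variable {κ : Cardinal.{u}} {ι : Type u} {τ : ι → S}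

theorem le_localRank_tp_iff (hM : IsBigModel L M κ) (hι : #ι < κ) {C : Set (Elem M)} (hC : #C < κ)
    {Δ : Set (LocalPair L τ)} {a : Tuple M τ} {n : ℕ} :
    (n : ℕ∞) ≤ localRank Δ (tp L a C) ↔ HasPattern Δ a Set.univ n C := by
  have key : ∀ {m : ℕ}, (∃ ξ : Fin m → LocalPair L τ, (∀ i, ξ i ∈ Δ) ∧
      IsDividingPattern (tp L a C) ξ) ↔ HasPattern Δ a Set.univ m C := by
    intro m
    constructor
    · rintro ⟨ξ, hξ, b, ⟨a', ha', hl⟩, hd⟩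
      -- The pattern is realised by some `a'` of the same type, and conjugating over `C` transfers
      -- it to `a`.
      obtain ⟨g, hg, rfl⟩ := exists_automorphism hM hι hC ha'.symm
      have h : HasPattern Δ a' Set.univ m C := hasPattern_iff.2 ⟨ξ, hξ, b, hl, hd⟩
      have := h.map g
      rw [hg.image] at this
      exact this.mono (Set.subset_univ _) subset_rfl
    · intro h
      obtain ⟨ξ, hξ, b, hl, hd⟩ := hasPattern_iff.1 h
      exact ⟨ξ, hξ, b, ⟨a, fun _ h => h, hl⟩, hd⟩
  constructor
  · intro h
    cases n with
    | zero => trivial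
    | succ n =>
      -- The supremum may be infinite: choose a pattern longer than `n` and truncate it.
      have hn : (n : ℕ∞) < localRank Δ (tp L a C) := lt_of_lt_of_le (by norm_cast; omega) h
      obtain ⟨m, hm⟩ := lt_iSup_iff.1 hn
      obtain ⟨hm, hnm⟩ := lt_iSup_iff.1 hm
      exact (key.1 hm).of_le (by exact_mod_cast hnm)
  · intro h
    exact le_iSup₂_of_le n (key.2 h) le_rfl

theorem HasPattern.le_localRank_empty {Δ : Set (LocalPair L τ)} {a : Tuple M τ}
    {W D : Set (Elem M)} {n : ℕ} (h : HasPattern Δ a W n D) :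
    (n : ℕ∞) ≤ localRank Δ (∅ : PartialType L τ (∅ : Set (Elem M))) := by
  obtain ⟨ξ, hξ, b, hl, hd⟩ := hasPattern_iff.1 (h.mono (Set.subset_univ _) (Set.empty_subset _))
  exact le_iSup₂_of_le n ⟨ξ, hξ, b, ⟨a, fun _ h => h.elim, hl⟩, hd⟩ le_rfl

theorem exists_forall_eq_of_toSet_subset {Y : Type*} {υ : Y → S} {a : Tuple M τ} {c : Tuple M υ}
    (h : c.toSet ⊆ a.toSet) :
    ∃ σ : Y → ι, ∀ j, (⟨υ j, c j⟩ : Elem M) = ⟨τ (σ j), a (σ j)⟩ := by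
  choose σ hσ using fun j => h ⟨j, rfl⟩
  exact ⟨σ, fun j => (hσ j).symm⟩

/-- If no conjugate of `a` over `D` is independent from `B` over `C`, then by compactness finitely
many pairs in `Ω` are responsible for this. -/
theorem exists_finite_of_forall_not_indep (hM : IsBigModel L M κ) {Ω : PairSet L} (hι : #ι < κ)
    {a : Tuple M τ} {B C D : Set (Elem M)} (hB : #B < κ) (hC : #C < κ) (hD : #D < κ)
    (h : ∀ g : Automorphism L M, g.Fixes D → ¬ Indep Ω (g.apply '' a.toSet) C B) :
    ∃ Δ ⊆ restrict Ω τ, Δ.Finite ∧ ∀ g : Automorphism L M, g.Fixes D →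
      ∃ P ∈ Δ, ∃ d : Tuple M P.υ, d.toSet ⊆ B ∪ C ∧
        P.pair.Left (fun j => g.map a (P.σ j)) d ∧ P.pair.Divides d C := by
  by_contra! hcon
  -- The type to realise is `tp(a/D)` with the negations of all `Ω`-formulas over `B ∪ C` that
  -- divide over `C`.
  obtain ⟨a', ha'⟩ := exists_of_finite_approx hM hι (C := D ∪ (B ∪ C))
    (union_lt hM hD (union_lt hM hB hC)) (restrict Ω τ)
    (fun a' => ∃ g : Automorphism L M, g.Fixes D ∧ g.map a = a')
    (fun P a' => ∀ d : Tuple M P.υ, d.toSet ⊆ B ∪ C →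
      P.pair.Left (fun j => a' (P.σ j)) d → ¬ P.pair.Divides d C)
    (fun Δ hΔ hfin => by
      obtain ⟨g, hg, hP⟩ := hcon Δ hΔ hfin
      exact ⟨g.map a, ⟨g, hg, rfl⟩, hP⟩)
    ({R | ∃ θ ∈ tp L a D, R = fun a' => Holds θ (a'.join (enum D))} ∪
      {R | ∃ P ∈ restrict Ω τ, ∃ d : Tuple M P.υ, d.toSet ⊆ B ∪ C ∧ P.pair.Divides d C ∧
        R = fun a' => ¬ P.pair.Left (fun j => a' (P.σ j)) d})
    (by
      rintro R (⟨θ, -, rfl⟩ | ⟨P, -, d, hd, -, rfl⟩)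
      · exact paramDef_holds ((TermDef.proj id).join
          (TermDef.const ((toSet_enum D).trans_subset Set.subset_union_left))) θ
      · exact (paramDef_holds ((TermDef.proj P.σ).join
          (TermDef.const (hd.trans Set.subset_union_right))) P.pair.φ).not)
    (by
      rintro R (⟨θ, hθ, rfl⟩ | ⟨P, hP, d, hd, hdiv, rfl⟩)
      · left
        rintro _ ⟨g, hg, rfl⟩
        exact realises_map_of_fixes hg a θ hθ
      · exact .inr ⟨P, hP, fun a' _ hq hl => hq d hd hl hdiv⟩)
  obtain ⟨g, hg, rfl⟩ := exists_automorphism hM hι hD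
    (show Realises a' (tp L a D) from fun θ hθ => ha' _ (.inl ⟨θ, hθ, rfl⟩))
  refine h g hg ?_
  rintro X _ υ c hc ⟨Y, hY, ζ, k, P, hP, d, hd, hl, hdiv⟩
  rw [← g.toSet_map] at hc
  -- A finite tuple from the conjugate is a reindexed subtuple, possibly with repetitions, so its
  -- pair belongs to `restrict Ω τ`.
  obtain ⟨σ, hσ⟩ := exists_forall_eq_of_toSet_subset hc
  obtain rfl : υ = τ ∘ σ := funext fun j => congrArg Sigma.fst (hσ j)
  obtain rfl : c = fun j => g.map a (σ j) := funext fun j => eq_of_heq (Sigma.mk.inj (hσ j)).2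
  exact ha' _ (.inr ⟨⟨σ, ζ, k, P⟩, hP, d, hd, hdiv, rfl⟩) hl

variable {Ω : PairSet L}

theorem indepStar_of_localRank_eq (hM : IsBigModel L M κ)
    (hfin : ∀ Δ : Set (LocalPair L τ), Δ.Finite → Δ ⊆ restrict Ω τ →
      localRank Δ (∅ : PartialType L τ (∅ : Set (Elem M))) < ⊤)
    (hι : #ι < κ) {a : Tuple M τ} {B C : Set (Elem M)} (hB : #B < κ) (hC : #C < κ)
    (h : ∀ Δ : Set (LocalPair L τ), Δ.Finite → Δ ⊆ restrict Ω τ →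
      localRank Δ (tp L a (B ∪ C)) = localRank Δ (tp L a C)) :
    IndepStar Ω κ a.toSet C B := by
  intro B' hB' hBB'
  by_contra! hcon
  have hBC := union_lt hM hB hC
  obtain ⟨Δ, hΔ, hΔfin, hcov⟩ := exists_finite_of_forall_not_indep hM hι hB' hC hBC hcon
  have hall : ∀ n : ℕ, HasPattern Δ a Set.univ n (B ∪ C) := by
    intro n
    induction n with
    | zero => trivial
    | succ n ih =>
      obtain ⟨g, hg, hpat⟩ := ih.exists_map hM (D := B' ∪ C) (union_lt hM hB' hC)
        (Set.union_subset_union_left _ hBB')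
      obtain ⟨P, hP, d, hd, hl, hdiv⟩ := hcov g hg
      have h1 : HasPattern Δ (g.map a) Set.univ (n + 1) C :=
        ⟨P, hP, d, Set.subset_univ _, hl, hdiv,
          hpat.mono subset_rfl (Set.union_subset Set.subset_union_right hd)⟩
      have h2 := h1.map g.symm
      rw [g.symm_map_map, (hg.mono Set.subset_union_right).symm.image] at h2
      -- Only here does equality of ranks enter: the longer pattern, found over `C`, is traded for
      -- one over `B ∪ C`.
      rw [← le_localRank_tp_iff hM hι hBC, h Δ hΔfin hΔ, le_localRank_tp_iff hM hι hC]
      exact h2.mono (Set.subset_univ _) subset_rfl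
  exact (hfin Δ hΔfin hΔ).ne (ENat.eq_top_iff_forall_ge.2 fun n => (hall n).le_localRank_empty)

theorem localRank_eq_of_indepStar (hM : IsBigModel L M κ)
    (hΞ : IsSetOfInconsistencyPairs M Ω) (hsubst : ClosedUnderSubstitution M Ω)
    (htrans : IsTransitive M Ω κ) (hnormal : IsNormal M Ω)
    (hι : #ι < κ) {a : Tuple M τ} {B C : Set (Elem M)} (hB : #B < κ) (hC : #C < κ)
    (h : IndepStar Ω κ B C a.toSet) {Δ : Set (LocalPair L τ)} (hΔ : Δ ⊆ restrict Ω τ) :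
    localRank Δ (tp L a (B ∪ C)) = localRank Δ (tp L a C) := by
  refine ENat.eq_of_forall_natCast_le_iff fun n => ?_
  rw [le_localRank_tp_iff hM hι hC, le_localRank_tp_iff hM hι (union_lt hM hB hC)]
  refine ⟨fun hp => hp.mono subset_rfl Set.subset_union_right, fun hp => ?_⟩
  obtain ⟨W, hW, hp⟩ := hp.exists_finite
  -- The starred relation supplies independence from the pattern's parameters too, while `g` fixes
  -- `a`.
  obtain ⟨g, hg, hi⟩ := h (a.toSet ∪ W)
    (union_lt hM (mk_range_le.trans_lt hι) (finite_lt hM hW)) Set.subset_union_left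
  have hg : g.Fixes (a.toSet ∪ C) := hg
  have h1 := (hp.union_of_indep hM hΞ hsubst htrans hnormal hΔ (mk_image_le.trans_lt hB) hC
    (hi.mono subset_rfl (by grind))).map g.symm
  rw [Set.image_union, g.symm_image_image, (hg.mono Set.subset_union_right).symm.image,
    hg.symm.map_eq Set.subset_union_left, Set.union_comm] at h1
  exact h1.mono (Set.subset_univ _) subset_rfl

theorem indepStar_symm (hM : IsBigModel L M κ)
    (hΞ : IsSetOfInconsistencyPairs M Ω) (hsubst : ClosedUnderSubstitution M Ω)
    (htrans : IsTransitive M Ω κ) (hnormal : IsNormal M Ω)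
    (hfin : ∀ ⦃ι : Type u⦄ (τ : ι → S), #ι < κ →
      ∀ Δ : Set (LocalPair L τ), Δ.Finite → Δ ⊆ restrict Ω τ →
        localRank Δ (∅ : PartialType L τ (∅ : Set (Elem M))) < ⊤)
    {A B C : Set (Elem M)} (hA : #A < κ) (hB : #B < κ) (hC : #C < κ)
    (h : IndepStar Ω κ A C B) : IndepStar Ω κ B C A := by
  intro A' hA' hAA'
  by_contra! hcon
  obtain ⟨Δ, hΔ, hΔfin, hcov⟩ := exists_finite_of_forall_not_indep hM (a := enum B) hB hA' hC
    (union_lt hM hA hC) (by rw [toSet_enum]; exact hcon)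
  have hstep : ∀ n : ℕ, ∃ W : Set (Elem M), #W < κ ∧ HasPattern Δ (enum B) W n C := by
    intro n
    induction n with
    | zero => exact ⟨∅, finite_lt hM Set.finite_empty, trivial⟩
    | succ n ih =>
      obtain ⟨W, hW, hp⟩ := ih
      obtain ⟨g, hg, hi⟩ := h (B ∪ W) (union_lt hM hB hW) Set.subset_union_left
      have hg : g.Fixes (B ∪ C) := hg
      have hgC := hg.mono Set.subset_union_right
      -- Existence: over an empty extension the ranks agree trivially.
      have hex : IndepStar Ω κ (enum A').toSet (A ∪ C) ∅ :=
        indepStar_of_localRank_eq hM (hfin _ hA') hA' (finite_lt hM Set.finite_empty)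
          (union_lt hM hA hC) fun Δ _ _ => by rw [Set.empty_union]
      -- The target is `g⁻¹W`, so that applying `g` gives independence from `W` over `C ∪ gA`.
      obtain ⟨f, hf, hfi⟩ := hex (g.symm.apply '' W) (mk_image_le.trans_lt hW)
        (Set.empty_subset _)
      have hf : f.Fixes (A ∪ C) := fun e he => hf e (.inr he)
      have hi' := hfi.map g
      rw [toSet_enum, g.image_symm_image, Set.image_union, hgC.image, Set.union_comm] at hi'
      have hind := (hi.mono subset_rfl (by grind : W ⊆ B ∪ W ∪ C)).trans hM hΞ hsubst htrans
        hnormal (mk_image_le.trans_lt hA) hC hi'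
      -- Taking the conjugate `f⁻¹B` ensures that `f` followed by `g` returns it to `B`, while
      -- sending `d` into `gfA' ∪ C`, which is independent from `W` over `C`.
      obtain ⟨P, hP, d, hd, hl, hdiv⟩ := hcov f.symm hf.symm
      have hCfix : (f.trans g).Fixes C := (hf.mono Set.subset_union_right).trans hgC
      let e := (f.trans g).map d
      have hee : e.toSet ⊆ g.apply '' (f.apply '' A') ∪ C := by
        have := Set.image_mono (f := (f.trans g).apply) hd
        rwa [Set.image_union, hCfix.image, ← (f.trans g).toSet_map d,
          Automorphism.image_trans] at this
      have hle : P.pair.Left (fun j => enum B (P.σ j)) e := by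
        have := (P.pair.left_map (f.trans g) _ _).2 hl
        have hb : (f.trans g).map (f.symm.map (enum B)) = enum B := by
          change g.map (f.map (f.symm.map (enum B))) = enum B
          rw [f.map_symm_map]
          exact hg.map_eq ((toSet_enum B).trans_subset Set.subset_union_left)
        have hb' : (f.trans g).map (τ := sortsOf B ∘ P.σ)
            (fun j => f.symm.map (enum B) (P.σ j)) = fun j => enum B (P.σ j) :=
          funext fun j => congrFun hb (P.σ j)
        rwa [hb'] at this
      have hde : P.pair.Divides e C := by
        have := hdiv.map (f.trans g)
        rwa [hCfix.image] at this
      have hie : Indep Ω e.toSet C W :=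
        (hind.union_base hΞ hsubst hnormal).mono (by grind) Set.subset_union_left
      refine ⟨W ∪ e.toSet, union_lt hM hW (finite_lt hM (toSet_finite _)), P, hP, e,
        Set.subset_union_right, hle, hde, ?_⟩
      exact (hp.union_of_indep hM hΞ hsubst htrans hnormal hΔ
        (finite_lt hM (toSet_finite _)) hC hie).mono Set.subset_union_left subset_rfl
  refine (hfin _ hB Δ hΔfin hΔ).ne (ENat.eq_top_iff_forall_ge.2 fun n => ?_)
  obtain ⟨W, -, hp⟩ := hstep n
  exact hp.le_localRank_empty

end Rank

end LocalForking

theorem mainTheorem8 {S : Type u} (L : SortedLanguage S) (M : S → Type u) [L.Structure M]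
    (κ : Cardinal.{u}) (hM : LocalForking.IsBigModel L M κ)
    (Ω : LocalForking.PairSet L)
    (hΞ : LocalForking.IsSetOfInconsistencyPairs M Ω)
    (hsubst : LocalForking.ClosedUnderSubstitution M Ω)
    (htrans : LocalForking.IsTransitive M Ω κ)
    (hnormal : LocalForking.IsNormal M Ω)
    (hfin : ∀ ⦃ι : Type u⦄ (τ : ι → S), #ι < κ →
      ∀ Δ : Set (LocalForking.LocalPair L τ), Δ.Finite → Δ ⊆ LocalForking.restrict Ω τ →
        LocalForking.localRank Δ (∅ : LocalForking.PartialType L τ (∅ : Set (LocalForking.Elem M)))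
          < ⊤) :
    (∀ ⦃ι : Type u⦄ (τ : ι → S), #ι < κ →
      ∀ (a : LocalForking.Tuple M τ) (B C : Set (LocalForking.Elem M)), #B < κ → #C < κ →
        List.TFAE [
          LocalForking.IndepStar Ω κ a.toSet C B,
          ∀ Δ : Set (LocalForking.LocalPair L τ), Δ.Finite → Δ ⊆ LocalForking.restrict Ω τ →
            LocalForking.localRank Δ (LocalForking.tp L a (B ∪ C)) =
              LocalForking.localRank Δ (LocalForking.tp L a C),
          LocalForking.IndepStar Ω κ B C a.toSet]) ∧
    (∀ A B C : Set (LocalForking.Elem M), #A < κ → #B < κ → #C < κ →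
      (LocalForking.IndepStar Ω κ A C B ↔ LocalForking.IndepStar Ω κ B C A)) := by
  refine ⟨fun ι τ hι a B C hB hC => ?_, fun A B C hA hB hC =>
    ⟨LocalForking.indepStar_symm hM hΞ hsubst htrans hnormal hfin hA hB hC,
      LocalForking.indepStar_symm hM hΞ hsubst htrans hnormal hfin hB hA hC⟩⟩
  -- The cycle is not circular: this implication rests on 2 → 1 for another tuple with empty `B`.
  tfae_have 1 → 3 := LocalForking.indepStar_symm hM hΞ hsubst htrans hnormal hfin
    (mk_range_le.trans_lt hι) hB hC
  tfae_have 3 → 2 := fun h _ _ hΔ =>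
    LocalForking.localRank_eq_of_indepStar hM hΞ hsubst htrans hnormal hι hB hC h hΔ
  tfae_have 2 → 1 := LocalForking.indepStar_of_localRank_eq hM (hfin τ hι) hι hB hC
  tfae_finish
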